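/- Let $n\ge 1$ and let $A$ be a dilation matrix, i.e. an $n\times n$ integer matrix all of whose complex eigenvalues $\lambda$ satisfy $|\lambda|>1$. For $D\subset\mathbb{Z}^n$ put $$T(A,D)=\Big\{\sum_{j=1}^{\infty}A^{-j}d_j:\ d_j\in D \text{ for all } j\ge 1\Big\}\subset\mathbb{R}^n .$$ A multiresolution analysis (MRA) of $L^2(\mathbb{R}^n)$ (real or complex valued functions) associated with $A$ is a nested sequence $\cdots\subset V_{-1}\subset V_0\subset V_1\subset\cdots$ of closed subspaces of $L^2(\mathbb{R}^n)$ such that (1) $\overline{\bigcup_{j\in\mathbb{Z}}V_j}=L^2(\mathbb{R}^n)$; (2) $\bigcap_{j\in\mathbb{Z}}V_j=\{0\}$; (3) for all $j\in\mathbb{Z}$, $f(x)\in V_j$ if and only if $f(Ax)\in V_{j+1}$; (4) for all $k\in\mathbb{Z}^n$, $f(x)\in V_0$ if and only if $f(x-k)\in V_0$; (5) there is $\varphi\in V_0$, called a scaling function of the MRA, such that $\{\varphi(x-k):k\in\mathbb{Z}^n\}$ is a complete orthonormal system in $V_0$. **Theorem.** (a) Let $D\subset\mathbb{Z}^n$ be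 a complete set of representatives of $\mathbb{Z}^n/A(\mathbb{Z}^n)$ with $0\in D$, and suppose that $A$ yields a radix representation of $\mathbb{Z}^n$ with digit set $D$, i.e. every $x\in\mathbb{Z}^n$ can be written as $x=\sum_{j=0}^{N}A^jd_j$ with $N\ge 0$ and $d_0,\dots,d_N\in D$. Then the characteristic function $\chi_{T(A,D)}$ is a scaling function of an MRA of $L^2(\mathbb{R}^n)$ associated with $A$. (b) In particular, if the smallest singular value $\mu$ of $A$ satisfies $\mu>2$ and $D=A\big([-\tfrac12,\tfrac12)^n\big)\cap\mathbb{Z}^n$, then $\chi_{T(A,D)}$ is a scaling function of an MRA of $L^2(\mathbb{R}^n)$ associated with $A$. -/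

import Mathlib

open MeasureTheory
open scoped Matrix

noncomputable section

namespace RadixMRA

variable {n : ℕ}

/-- The inclusion of the lattice `ℤⁿ` into `ℝⁿ`. -/
def toReal (k : Fin n → ℤ) : Fin n → ℝ := fun i => (k i : ℝ)

/-- The integer matrix `A`, viewed as a real matrix. -/
def realMatrix (A : Matrix (Fin n) (Fin n) ℤ) : Matrix (Fin n) (Fin n) ℝ :=
  A.map (fun a => (a : ℝ))

/-- A dilation matrix: an integer matrix all of whose complex eigenvalues have modulus `> 1`. -/
def IsDilationMatrix (A : Matrix (Fin n) (Fin n) ℤ) : Prop :=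
  ∀ z : ℂ, Module.End.HasEigenvalue (Matrix.toLin' (A.map (fun a => (a : ℂ)))) z → 1 < ‖z‖

/-- A digit set: a complete set of representatives of the cosets of `A(ℤⁿ)` in `ℤⁿ`. -/
def IsDigitSet (A : Matrix (Fin n) (Fin n) ℤ) (D : Set (Fin n → ℤ)) : Prop :=
  ∀ x : Fin n → ℤ, ∃! d : Fin n → ℤ, d ∈ D ∧ ∃ y : Fin n → ℤ, x = A *ᵥ y + d

/-- Every `x ∈ ℤⁿ` is a finite sum `∑_{j=0}^N A^j d_j` with digits `d_j ∈ D`. -/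
def YieldsRadixRepresentation (A : Matrix (Fin n) (Fin n) ℤ) (D : Set (Fin n → ℤ)) : Prop :=
  ∀ x : Fin n → ℤ, ∃ (N : ℕ) (d : ℕ → Fin n → ℤ),
    (∀ j ≤ N, d j ∈ D) ∧ x = ∑ j ∈ Finset.range (N + 1), (A ^ j) *ᵥ d j

/-- The set `T(A, D)` of all sums `∑_{j ≥ 1} A^{-j} d_j` with digits `d_j ∈ D`
(here the digit `d_{j+1}` is called `d j`). -/
def tile (A : Matrix (Fin n) (Fin n) ℤ) (D : Set (Fin n → ℤ)) : Set (Fin n → ℝ) :=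
  {ξ | ∃ d : ℕ → Fin n → ℤ, (∀ j, d j ∈ D) ∧
    HasSum (fun j : ℕ => ((realMatrix A)⁻¹ ^ (j + 1)) *ᵥ toReal (d j)) ξ}

/-- The smallest singular value of `A`, with respect to the Euclidean norm (for `n ≥ 1`). -/
def minSingularValue (A : Matrix (Fin n) (Fin n) ℤ) : ℝ :=
  ⨅ i : Fin n, (Matrix.toEuclideanLin (realMatrix A)).singularValues i

/-- The fundamental domain `F = [-1/2, 1/2)ⁿ` of `ℤⁿ`. -/
def centeredCube (n : ℕ) : Set (Fin n → ℝ) :=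
  {x | ∀ i, x i ∈ Set.Ico (-(1 / 2) : ℝ) (1 / 2)}

/-- The set `A(F) ∩ ℤⁿ`. -/
def centeredDigits (A : Matrix (Fin n) (Fin n) ℤ) : Set (Fin n → ℤ) :=
  {d | toReal d ∈ (fun x => realMatrix A *ᵥ x) '' centeredCube n}

/-- The space `L²(ℝⁿ)` of (classes of) `𝕜`-valued functions, for Lebesgue measure. -/
abbrev L2 (𝕜 : Type*) [RCLike 𝕜] (n : ℕ) : Type _ :=
  Lp 𝕜 2 (volume : Measure (Fin n → ℝ))

/-- The function `f` represents an element of the subspace `W` of `L²(ℝⁿ)`. -/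
def Represents {𝕜 : Type*} [RCLike 𝕜] (W : Submodule 𝕜 (L2 𝕜 n)) (f : (Fin n → ℝ) → 𝕜) : Prop :=
  ∃ g ∈ W, (g : (Fin n → ℝ) → 𝕜) =ᵐ[volume] f

/-- `φ ∈ W`, and its translates `φ(x - k)`, `k ∈ ℤⁿ`, form a complete orthonormal system in `W`. -/
def IsScalingFunction {𝕜 : Type*} [RCLike 𝕜] (W : Submodule 𝕜 (L2 𝕜 n))
    (φ : (Fin n → ℝ) → 𝕜) : Prop :=
  Represents W φ ∧
  ∃ e : (Fin n → ℤ) → L2 𝕜 n,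
    (∀ k, (e k : (Fin n → ℝ) → 𝕜) =ᵐ[volume] fun x => φ (x - toReal k)) ∧
    Orthonormal 𝕜 e ∧
    (Submodule.span 𝕜 (Set.range e)).topologicalClosure = W

/-- A multiresolution analysis of `L²(ℝⁿ)` associated with the matrix `A`. -/
structure IsMRA {𝕜 : Type*} [RCLike 𝕜] (A : Matrix (Fin n) (Fin n) ℤ)
    (V : ℤ → Submodule 𝕜 (L2 𝕜 n)) : Prop where
  isClosed : ∀ j, IsClosed (V j : Set (L2 𝕜 n))
  nested : ∀ j, V j ≤ V (j + 1)
  dense : closure (⋃ j, (V j : Set (L2 𝕜 n))) = Set.univ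
  separated : (⋂ j, (V j : Set (L2 𝕜 n))) = {0}
  dilation : ∀ (j : ℤ) (f : (Fin n → ℝ) → 𝕜),
    Represents (V j) f ↔ Represents (V (j + 1)) (fun x => f (realMatrix A *ᵥ x))
  translation : ∀ (k : Fin n → ℤ) (f : (Fin n → ℝ) → 𝕜),
    Represents (V 0) f ↔ Represents (V 0) (fun x => f (x - toReal k))
  scaling : ∃ φ : (Fin n → ℝ) → 𝕜, IsScalingFunction (V 0) φ

/-- `φ` is the scaling function of some multiresolution analysis associated with `A`. -/
def IsScalingFunctionOfMRA {𝕜 : Type*} [RCLike 𝕜] (A : Matrix (Fin n) (Fin n) ℤ)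
    (φ : (Fin n → ℝ) → 𝕜) : Prop :=
  ∃ V : ℤ → Submodule 𝕜 (L2 𝕜 n), IsMRA A V ∧ IsScalingFunction (V 0) φ

end RadixMRA

end

/-! Write `T` for the tile and `D_m` for the set of sums `∑_{j<m} A^j d_j`. Self-affinity gives `A^m
T = T + D_m`, where `D_m` has at most `|D|^m = |det A|^m` elements. The left side has measure `|det
A|^m vol T`, so the translates forming the right side leave no room for overlap of positive measure.
The radix hypothesis puts every integer vector in some `D_m`, and `0 ∈ D_m` for all `m`. Hence all
distinct integer translates of `T` are almost disjoint (`volume_tile_overlap_eq_zero`). They also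
cover space (`exists_sub_mem_tile`), so `T` is a fundamental domain of `ℤⁿ` and has measure one.

Take `V_j` to be the square integrable functions constant on the cells `A^{-j}(T + k)`.
Self-affinity makes these spaces nested. A function in all of them is constant on the sets `A^m T`,
which exhaust space by the radix hypothesis; being square integrable, it vanishes. The union is
dense because cell diameters tend to zero.

For centered digits, write `x = A y + d` with `y` a rounding of `A⁻¹ x`. Rounding at most doubles
each coordinate in absolute value, so a smallest singular value above 2 gives `|y| < |x|` for `x ≠
0`, and descent terminates. -/

noncomputable section

namespace RadixMRA

open Filter Topology

/-! ### Integer matrices and digit sets -/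

section Algebra

variable {n : ℕ} {A : Matrix (Fin n) (Fin n) ℤ}

@[simp] lemma toReal_apply (k : Fin n → ℤ) (i : Fin n) : toReal k i = (k i : ℝ) := rfl

@[simp] lemma toReal_zero : toReal (0 : Fin n → ℤ) = 0 := by ext; simp

lemma toReal_add (k l : Fin n → ℤ) : toReal (k + l) = toReal k + toReal l := by ext; simp

lemma toReal_sub (k l : Fin n → ℤ) : toReal (k - l) = toReal k - toReal l := by ext; simp

lemma toReal_injective : Function.Injective (toReal (n := n)) := by
  intro k l h
  ext i
  have := congrFun h i
  rw [toReal_apply, toReal_apply] at this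
  exact_mod_cast this

lemma realMatrix_mulVec_toReal (A : Matrix (Fin n) (Fin n) ℤ) (k : Fin n → ℤ) :
    realMatrix A *ᵥ toReal k = toReal (A *ᵥ k) := by
  ext i
  simp [realMatrix, Matrix.mulVec, dotProduct]

lemma det_realMatrix (A : Matrix (Fin n) (Fin n) ℤ) : (realMatrix A).det = (A.det : ℝ) :=
  ((Int.castRingHom ℝ).map_det A).symm

lemma IsDilationMatrix.det_ne_zero (hA : IsDilationMatrix A) : A.det ≠ 0 := by
  intro h
  have h0 : (A.map (fun a => (a : ℂ))).det = 0 := by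
    have := ((Int.castRingHom ℂ).map_det A).symm
    rw [h, map_zero] at this
    exact this
  obtain ⟨v, hv, hAv⟩ := Matrix.exists_mulVec_eq_zero_iff.2 h0
  have : Module.End.HasEigenvalue (Matrix.toLin' (A.map (fun a => (a : ℂ)))) 0 := by
    refine Module.End.hasEigenvalue_of_hasEigenvector (x := v) ?_
    rw [Module.End.hasEigenvector_iff, Module.End.mem_eigenspace_iff]
    exact ⟨by simpa using hAv, hv⟩
  have := hA 0 this
  norm_num at this

lemma isUnit_det_realMatrix (hA : A.det ≠ 0) : IsUnit (realMatrix A).det := by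
  rw [det_realMatrix, isUnit_iff_ne_zero]
  exact_mod_cast hA

lemma inv_mulVec_mulVec (hA : A.det ≠ 0) (v : Fin n → ℝ) :
    (realMatrix A)⁻¹ *ᵥ (realMatrix A *ᵥ v) = v := by
  rw [Matrix.mulVec_mulVec, Matrix.nonsing_inv_mul _ (isUnit_det_realMatrix hA), Matrix.one_mulVec]

lemma mulVec_inv_mulVec (hA : A.det ≠ 0) (v : Fin n → ℝ) :
    realMatrix A *ᵥ ((realMatrix A)⁻¹ *ᵥ v) = v := by
  rw [Matrix.mulVec_mulVec, Matrix.mul_nonsing_inv _ (isUnit_det_realMatrix hA), Matrix.one_mulVec]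

lemma mulVec_int_injective (hA : A.det ≠ 0) : Function.Injective (fun v => A *ᵥ v) := by
  intro v w h
  apply toReal_injective
  rw [← inv_mulVec_mulVec hA (toReal v), ← inv_mulVec_mulVec hA (toReal w),
    realMatrix_mulVec_toReal, realMatrix_mulVec_toReal]
  exact congrArg _ (congrArg toReal h)

/-- A digit set has exactly `|det A|` elements. -/
lemma IsDigitSet.natCard_eq {D : Set (Fin n → ℤ)} (hA : A.det ≠ 0) (hD : IsDigitSet A D) :
    Nat.card D = A.det.natAbs := by
  let N : Submodule ℤ (Fin n → ℤ) := LinearMap.range (Matrix.toLin' A)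
  let e : (Fin n → ℤ) ≃ₗ[ℤ] N := LinearEquiv.ofInjective (Matrix.toLin' A) (by
    intro v w h
    exact mulVec_int_injective hA (by simpa using h))
  have h1 := Submodule.natAbs_det_equiv N e
  have h2 : N.subtype ∘ₗ AddMonoidHom.toIntLinearMap (e : (Fin n → ℤ) →+ N) = Matrix.toLin' A := by
    ext; rfl
  rw [h2, LinearMap.det_toLin'] at h1
  rw [h1]
  have hmem : ∀ x y : Fin n → ℤ, (Submodule.Quotient.mk x : (Fin n → ℤ) ⧸ N) =
      Submodule.Quotient.mk y ↔ ∃ z, x = A *ᵥ z + y := by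
    intro x y
    rw [Submodule.Quotient.eq]
    constructor
    · rintro ⟨z, hz⟩
      exact ⟨z, by rw [Matrix.toLin'_apply] at hz; rw [hz]; abel⟩
    · rintro ⟨z, hz⟩
      exact ⟨z, by rw [Matrix.toLin'_apply, hz]; abel⟩
  refine Nat.card_eq_of_bijective
    (fun d : D => (Submodule.Quotient.mk d.1 : (Fin n → ℤ) ⧸ N)) ⟨?_, ?_⟩
  · intro d d' h
    obtain ⟨z, hz⟩ := (hmem _ _).1 h
    exact Subtype.ext ((hD d.1).unique ⟨d.2, 0, by simp⟩ ⟨d'.2, z, hz⟩)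
  · intro q
    obtain ⟨x, rfl⟩ := Submodule.Quotient.mk_surjective N q
    obtain ⟨d, ⟨hd, y, hy⟩, -⟩ := hD x
    exact ⟨⟨d, hd⟩, ((hmem _ _).2 ⟨y, hy⟩).symm⟩

lemma IsDigitSet.finite {D : Set (Fin n → ℤ)} (hA : A.det ≠ 0) (hD : IsDigitSet A D) :
    D.Finite := by
  have h := hD.natCard_eq hA
  have : 0 < Nat.card D := by rw [h]; exact Int.natAbs_pos.2 hA
  exact Nat.finite_of_card_ne_zero this.ne'

end Algebra

/-! ### Exponential decay of the powers of the inverse matrix -/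

section Decay

attribute [local instance] Matrix.linftyOpNormedRing Matrix.linftyOpNormedAlgebra

/-- Gelfand's formula bounds `‖a ^ m‖` by `s ^ m` for large `m`, for any `s` strictly between the
spectral radius and 1. The constant `C` absorbs the remaining finitely many powers. -/
lemma exists_norm_pow_le_of_spectrum_lt_one {E : Type*} [NormedRing E] [NormedAlgebra ℂ E]
    [CompleteSpace E] [Nontrivial E] (a : E) (ha : ∀ z ∈ spectrum ℂ a, ‖z‖ < 1) :
    ∃ C r : ℝ, 0 ≤ C ∧ 0 < r ∧ r < 1 ∧ ∀ m : ℕ, ‖a ^ m‖ ≤ C * r ^ m := by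
  have h1 : spectralRadius ℂ a < 1 := by
    have := spectrum.spectralRadius_lt_of_forall_lt a (r := 1) (fun z hz => ha z hz)
    simpa using this
  obtain ⟨s, hs1, hs2⟩ := exists_between h1
  lift s to NNReal using (hs2.trans ENNReal.one_lt_top).ne
  have hs0 : 0 < s := by
    have := (zero_le).trans_lt hs1
    exact_mod_cast this
  have h2 := (spectrum.pow_nnnorm_pow_one_div_tendsto_nhds_spectralRadius a).eventually_lt_const hs1
  have h3 : (fun m : ℕ => a ^ m) =O[atTop] (fun m : ℕ => (s : ℝ) ^ m) := by
    refine Asymptotics.IsBigO.of_bound 1 ?_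
    filter_upwards [h2, eventually_gt_atTop 0] with m hm hm0
    have hm' : ((‖a ^ m‖₊ : ENNReal) ^ (1 / (m : ℝ))) ^ (m : ℝ) ≤ (s : ENNReal) ^ (m : ℝ) :=
      ENNReal.rpow_le_rpow hm.le (by positivity)
    rw [← ENNReal.rpow_mul, one_div, inv_mul_cancel₀ (by positivity), ENNReal.rpow_one,
      ENNReal.rpow_natCast] at hm'
    have hm'' : ‖a ^ m‖₊ ≤ s ^ m := by exact_mod_cast hm'
    rw [one_mul, Real.norm_of_nonneg (by positivity)]
    exact_mod_cast hm''
  obtain ⟨C, hC, h⟩ := Asymptotics.bound_of_isBigO_nat_atTop h3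
  refine ⟨C, s, hC.le, by exact_mod_cast hs0, by exact_mod_cast hs2, fun m => ?_⟩
  have hp : (0 : ℝ) < (s : ℝ) ^ m := by positivity
  have := h (x := m) hp.ne'
  rwa [Real.norm_of_nonneg hp.le] at this

variable {n : ℕ} {A : Matrix (Fin n) (Fin n) ℤ}

/-- An eigenvector of the inverse for `z` is an eigenvector of `A` for `z⁻¹`. -/
lemma norm_lt_one_of_mem_spectrum_inv (hA : IsDilationMatrix A) {z : ℂ}
    (hz : z ∈ spectrum ℂ (((realMatrix A)⁻¹).map (fun x : ℝ => (x : ℂ)))) : ‖z‖ < 1 := by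
  rw [← Matrix.spectrum_toLin', ← Module.End.hasEigenvalue_iff_mem_spectrum] at hz
  obtain ⟨v, hv⟩ := hz.exists_hasEigenvector
  have hv0 := hv.2
  have hv1 := hv.apply_eq_smul
  rw [Matrix.toLin'_apply] at hv1
  have hmul : A.map (fun a => (a : ℂ)) * ((realMatrix A)⁻¹).map (fun x : ℝ => (x : ℂ)) = 1 := by
    have h := congrArg (fun M : Matrix (Fin n) (Fin n) ℝ => M.map Complex.ofRealHom)
      (Matrix.mul_nonsing_inv _ (isUnit_det_realMatrix hA.det_ne_zero))
    simp only [Matrix.map_mul] at h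
    rw [Matrix.map_one _ (map_zero _) (map_one _)] at h
    convert h using 2
    · ext i j
      simp [realMatrix]
    · rfl
  have hv2 : v = z • (A.map (fun a => (a : ℂ)) *ᵥ v) := by
    rw [← Matrix.mulVec_smul, ← hv1, Matrix.mulVec_mulVec, hmul, Matrix.one_mulVec]
  have hz0 : z ≠ 0 := by
    rintro rfl
    exact hv0 (by simpa using hv2)
  have hev : Module.End.HasEigenvalue (Matrix.toLin' (A.map (fun a => (a : ℂ)))) z⁻¹ := by
    refine Module.End.hasEigenvalue_of_hasEigenvector (x := v) ?_
    rw [Module.End.hasEigenvector_iff, Module.End.mem_eigenspace_iff]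
    refine ⟨?_, hv0⟩
    rw [Matrix.toLin'_apply]
    nth_rewrite 2 [hv2]
    rw [smul_smul, inv_mul_cancel₀ hz0, one_smul]
  have := hA _ hev
  rw [norm_inv] at this
  exact (one_lt_inv₀ (norm_pos_iff.2 hz0)).1 this

/-- The powers of the inverse of a dilation matrix decay exponentially. -/
lemma IsDilationMatrix.exists_norm_inv_pow_mulVec_le (hn : 1 ≤ n) (hA : IsDilationMatrix A) :
    ∃ C r : ℝ, 0 ≤ C ∧ 0 < r ∧ r < 1 ∧
      ∀ (m : ℕ) (v : Fin n → ℝ), ‖(realMatrix A)⁻¹ ^ m *ᵥ v‖ ≤ C * r ^ m * ‖v‖ := by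
  have : Nonempty (Fin n) := ⟨⟨0, hn⟩⟩
  obtain ⟨C, r, hC, hr0, hr1, h⟩ := exists_norm_pow_le_of_spectrum_lt_one
    (((realMatrix A)⁻¹).map (fun x : ℝ => (x : ℂ)))
    (fun z hz => norm_lt_one_of_mem_spectrum_inv hA hz)
  refine ⟨C, r, hC, hr0, hr1, fun m v => ?_⟩
  refine (Matrix.linfty_opNorm_mulVec _ _).trans ?_
  gcongr
  -- The maximal row-sum norm is unchanged when real entries are regarded as complex.
  refine le_trans (le_of_eq ?_) (h m)
  have h1 : ((realMatrix A)⁻¹).map (fun x : ℝ => (x : ℂ)) ^ m =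
      ((realMatrix A)⁻¹ ^ m).map (fun x : ℝ => (x : ℂ)) :=
    (map_pow (Complex.ofRealHom.mapMatrix) ((realMatrix A)⁻¹) m).symm
  rw [h1, Matrix.linfty_opNorm_def, Matrix.linfty_opNorm_def]
  simp

end Decay

/-! ### The tile: compactness, self-affinity, covering -/

section Tile

variable {n : ℕ} {A : Matrix (Fin n) (Fin n) ℤ} {D : Set (Fin n → ℤ)}

lemma summable_tile_series_bound {C r M : ℝ} (hr0 : 0 < r) (hr1 : r < 1) :
    Summable (fun j : ℕ => C * r ^ (j + 1) * M) := by
  have := (summable_geometric_of_lt_one hr0.le hr1).mul_left (C * M * r)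
  refine this.congr (fun j => ?_)
  ring

lemma exists_norm_digit_le (hD : D.Finite) : ∃ M : ℝ, 0 ≤ M ∧ ∀ d ∈ D, ‖toReal d‖ ≤ M := by
  obtain ⟨M, hM⟩ := (hD.image (fun d => ‖toReal d‖)).bddAbove
  exact ⟨max M 0, le_max_right _ _, fun d hd =>
    (hM (Set.mem_image_of_mem _ hd)).trans (le_max_left _ _)⟩

/-- The tile is compact. -/
lemma isCompact_tile (hn : 1 ≤ n) (hA : IsDilationMatrix A) (hD : D.Finite) :
    IsCompact (tile A D) := by
  obtain ⟨C, r, hC, hr0, hr1, hB⟩ := hA.exists_norm_inv_pow_mulVec_le hn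
  obtain ⟨M, hM0, hM⟩ := exists_norm_digit_le hD
  have : Finite D := hD
  have hbound : ∀ (j : ℕ) (d : ℕ → D),
      ‖(realMatrix A)⁻¹ ^ (j + 1) *ᵥ toReal (d j)‖ ≤ C * r ^ (j + 1) * M := fun j d =>
    (hB _ _).trans (by gcongr; exact hM _ (d j).2)
  -- Digit sequences form a compact space, a product of finite discrete ones; the tile is its image
  -- under a uniformly convergent series.
  have hcont : Continuous (fun d : ℕ → D =>
      ∑' j : ℕ, (realMatrix A)⁻¹ ^ (j + 1) *ᵥ toReal (d j)) := by
    refine continuous_tsum (fun j => ?_) (summable_tile_series_bound hr0 hr1) hbound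
    exact (continuous_of_discreteTopology
      (f := fun d : D => (realMatrix A)⁻¹ ^ (j + 1) *ᵥ toReal d)).comp (continuous_apply j)
  convert isCompact_range hcont using 1
  ext x
  constructor
  · rintro ⟨d, hd, hx⟩
    exact ⟨fun j => ⟨d j, hd j⟩, hx.tsum_eq⟩
  · rintro ⟨d, rfl⟩
    exact ⟨fun j => d j, fun j => (d j).2, (Summable.of_norm_bounded
      (summable_tile_series_bound hr0 hr1) (fun j => hbound j d)).hasSum⟩

lemma zero_mem_tile (h0 : (0 : Fin n → ℤ) ∈ D) : (0 : Fin n → ℝ) ∈ tile A D :=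
  ⟨fun _ => 0, fun _ => h0, by simp⟩

lemma mulVec_inv_pow_succ (hA : A.det ≠ 0) (j : ℕ) (v : Fin n → ℝ) :
    realMatrix A *ᵥ ((realMatrix A)⁻¹ ^ (j + 1) *ᵥ v) = (realMatrix A)⁻¹ ^ j *ᵥ v := by
  rw [pow_succ', ← Matrix.mulVec_mulVec, mulVec_inv_mulVec hA]

/-- The self-affinity of the tile: `A T = T + D`. -/
lemma mem_tile_iff (hA : A.det ≠ 0) {x : Fin n → ℝ} :
    x ∈ tile A D ↔ ∃ d ∈ D, realMatrix A *ᵥ x - toReal d ∈ tile A D := by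
  constructor
  · rintro ⟨d, hd, hx⟩
    refine ⟨d 0, hd 0, fun j => d (j + 1), fun j => hd _, ?_⟩
    -- Multiplication by `A` lowers every exponent by one: the first term becomes the integer vector
    -- `d 0`, the rest is again a tile series.
    have h1 := hx.map (Matrix.mulVecLin (realMatrix A))
      (LinearMap.continuous_of_finiteDimensional _)
    simp only [Function.comp_def, Matrix.mulVecLin_apply, mulVec_inv_pow_succ hA] at h1
    simpa using (hasSum_nat_add_iff' 1).2 h1
  · rintro ⟨d₀, hd₀, d, hd, hx⟩
    refine ⟨fun j => Nat.casesOn j d₀ d, fun j => by cases j <;> simp [hd₀, hd], ?_⟩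
    have h1 : HasSum (fun j : ℕ => (realMatrix A)⁻¹ ^ j *ᵥ
        toReal (Nat.casesOn j d₀ d : Fin n → ℤ)) (realMatrix A *ᵥ x) := by
      rw [← hasSum_nat_add_iff' 1]
      simpa using hx
    have h2 := h1.map (Matrix.mulVecLin (realMatrix A)⁻¹)
      (LinearMap.continuous_of_finiteDimensional _)
    simpa [Function.comp_def, inv_mulVec_mulVec hA, pow_succ'] using h2

lemma add_mem_tile (hA : A.det ≠ 0) {x : Fin n → ℝ} {d : Fin n → ℤ} (hd : d ∈ D)
    (hx : x ∈ tile A D) : (realMatrix A)⁻¹ *ᵥ (toReal d + x) ∈ tile A D :=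
  (mem_tile_iff hA).2 ⟨d, hd, by rw [mulVec_inv_mulVec hA]; simpa using hx⟩

lemma isClosed_range_toReal : IsClosed (Set.range (toReal (n := n))) := by
  have : Set.range (toReal (n := n)) = Set.pi Set.univ (fun _ => Set.range ((↑) : ℤ → ℝ)) := by
    ext x
    constructor
    · rintro ⟨k, rfl⟩ i -
      exact ⟨k i, rfl⟩
    · intro h
      choose k hk using fun i => h i (Set.mem_univ i)
      exact ⟨k, funext hk⟩
  rw [this]
  exact isClosed_set_pi (fun _ _ => Int.isClosedEmbedding_coe_real.isClosed_range)

open scoped Pointwise in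
/-- The integer translates of the tile cover the whole space. -/
lemma exists_sub_mem_tile (hn : 1 ≤ n) (hA : IsDilationMatrix A) (hD : IsDigitSet A D)
    (h0 : (0 : Fin n → ℤ) ∈ D) (x : Fin n → ℝ) : ∃ k : Fin n → ℤ, x - toReal k ∈ tile A D := by
  obtain ⟨C, r, hC, hr0, hr1, hB⟩ := hA.exists_norm_inv_pow_mulVec_le hn
  -- The error `A^{-m} u` shrinks by induction. Decompose `A x`, split its integer part as `A y +
  -- d`, and apply `A⁻¹`: the digit `d` is absorbed into the tile point and `y` is the new integer
  -- part.
  have key : ∀ (m : ℕ) (x : Fin n → ℝ), ∃ k : Fin n → ℤ, ∃ t ∈ tile A D, ∃ u : Fin n → ℝ,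
      ‖u‖ ≤ 1 ∧ x = toReal k + t + (realMatrix A)⁻¹ ^ m *ᵥ u := by
    intro m
    induction m with
    | zero =>
      intro x
      refine ⟨fun i => ⌊x i⌋, 0, zero_mem_tile h0, fun i => Int.fract (x i), ?_, ?_⟩
      · rw [pi_norm_le_iff_of_nonneg zero_le_one]
        intro i
        rw [Real.norm_of_nonneg (Int.fract_nonneg _)]
        exact (Int.fract_lt_one _).le
      · ext i
        simp
    | succ m ih =>
      intro x
      obtain ⟨k, t, ht, u, hu, hx⟩ := ih (realMatrix A *ᵥ x)
      obtain ⟨d, ⟨hd, y, hy⟩, -⟩ := hD k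
      refine ⟨y, _, add_mem_tile hA.det_ne_zero hd ht, u, hu, ?_⟩
      rw [← inv_mulVec_mulVec hA.det_ne_zero x, hx, hy, toReal_add, ← realMatrix_mulVec_toReal,
        pow_succ', ← Matrix.mulVec_mulVec]
      simp only [Matrix.mulVec_add, inv_mulVec_mulVec hA.det_ne_zero]
      abel
  -- Compact plus closed is closed, so `T + ℤⁿ` contains the limit `x` of the approximations.
  have hclosed : IsClosed (tile A D + Set.range (toReal (n := n))) :=
    isClosed_range_toReal.add_left_of_isCompact
      (isCompact_tile hn hA (hD.finite hA.det_ne_zero))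
  choose k t ht u hu hx using fun m => key m x
  have hlim : Tendsto (fun m => (realMatrix A)⁻¹ ^ m *ᵥ u m) atTop (𝓝 0) := by
    refine squeeze_zero_norm (a := fun m => C * r ^ m) (fun m => (hB _ _).trans ?_) ?_
    · exact mul_le_of_le_one_right (by positivity) (hu m)
    · simpa using (tendsto_pow_atTop_nhds_zero_of_lt_one hr0.le hr1).const_mul C
  have hlim' : Tendsto (fun m => t m + toReal (k m)) atTop (𝓝 x) := by
    have : (fun m => t m + toReal (k m)) = fun m => x - (realMatrix A)⁻¹ ^ m *ᵥ u m := by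
      ext1 m
      rw [eq_sub_iff_add_eq, add_comm (t m)]
      exact (hx m).symm
    rw [this]
    simpa using hlim.const_sub x
  obtain ⟨s, hs, -, ⟨l, rfl⟩, hxs⟩ := hclosed.mem_of_tendsto hlim'
    (Eventually.of_forall fun m => Set.add_mem_add (ht m) ⟨k m, rfl⟩)
  exact ⟨l, by rw [← hxs]; simpa using hs⟩

/-- The set of all sums `∑_{j < m} A^j d_j` with digits `d_j ∈ D`. -/
def digitSums (A : Matrix (Fin n) (Fin n) ℤ) (D : Finset (Fin n → ℤ)) : ℕ → Finset (Fin n → ℤ)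
  | 0 => {0}
  | m + 1 => Finset.image₂ (fun e d => A *ᵥ e + d) (digitSums A D m) D

lemma card_digitSums_le (D : Finset (Fin n → ℤ)) (m : ℕ) :
    (digitSums A D m).card ≤ D.card ^ m := by
  induction m with
  | zero => simp [digitSums]
  | succ m ih =>
    rw [digitSums, pow_succ]
    exact Finset.card_image₂_le _ _ _ |>.trans (Nat.mul_le_mul_right _ ih)

lemma zero_mem_digitSums {D : Finset (Fin n → ℤ)} (h0 : 0 ∈ D) (m : ℕ) :
    0 ∈ digitSums A D m := by
  induction m with
  | zero => simp [digitSums]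
  | succ m ih => exact Finset.mem_image₂.2 ⟨0, ih, 0, h0, by simp⟩

lemma sum_mem_digitSums {D : Finset (Fin n → ℤ)} (m : ℕ) (d : ℕ → Fin n → ℤ)
    (hd : ∀ j < m, d j ∈ D) : ∑ j ∈ Finset.range m, (A ^ j) *ᵥ d j ∈ digitSums A D m := by
  induction m generalizing d with
  | zero => simp [digitSums]
  | succ m ih =>
    refine Finset.mem_image₂.2 ⟨_, ih (fun j => d (j + 1)) (fun j hj => hd _ (by omega)), d 0,
      hd 0 (by omega), ?_⟩
    rw [Finset.sum_range_succ', Matrix.mulVec_sum]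
    simp [pow_succ', Matrix.mulVec_mulVec]

lemma exists_mem_digitSums {D : Finset (Fin n → ℤ)} (h : YieldsRadixRepresentation A D)
    (k : Fin n → ℤ) : ∃ m, k ∈ digitSums A D m := by
  obtain ⟨N, d, hd, rfl⟩ := h k
  exact ⟨N + 1, sum_mem_digitSums _ _ (fun j hj => hd j (by omega))⟩

/-- This is `A^m T = T + D_m`, obtained by iterating `A T = T + D`. -/
lemma inv_pow_mulVec_mem_tile_iff (hA : A.det ≠ 0) (D : Finset (Fin n → ℤ)) (m : ℕ)
    (x : Fin n → ℝ) : (realMatrix A)⁻¹ ^ m *ᵥ x ∈ tile A (D : Set (Fin n → ℤ)) ↔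
      ∃ e ∈ digitSums A D m, x - toReal e ∈ tile A (D : Set (Fin n → ℤ)) := by
  induction m generalizing x with
  | zero => simp [digitSums]
  | succ m ih =>
    rw [pow_succ, ← Matrix.mulVec_mulVec, ih]
    simp only [digitSums, Finset.mem_image₂]
    have key : ∀ e d : Fin n → ℤ,
        realMatrix A *ᵥ ((realMatrix A)⁻¹ *ᵥ x - toReal e) - toReal d =
          x - toReal (A *ᵥ e + d) := by
      intro e d
      rw [Matrix.mulVec_sub, mulVec_inv_mulVec hA, realMatrix_mulVec_toReal, toReal_add]
      abel
    constructor
    · rintro ⟨e, he, hx⟩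
      obtain ⟨d, hd, hx⟩ := (mem_tile_iff hA).1 hx
      exact ⟨_, ⟨e, he, d, hd, rfl⟩, by rwa [← key]⟩
    · rintro ⟨_, ⟨e, he, d, hd, rfl⟩, hx⟩
      exact ⟨e, he, (mem_tile_iff hA).2 ⟨d, hd, by rwa [key]⟩⟩

end Tile

/-! ### Almost disjoint translates and the measure of the tile -/

section Measure

/-- Equality in subadditivity forces null overlaps: merge `t i` and `t j` into their union, bound
the other sets by subadditivity, and cancel the finite measures. -/
lemma measure_inter_eq_zero_of_sum_le {α ι : Type*} [MeasurableSpace α] {μ : Measure α}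
    (s : Finset ι) (t : ι → Set α) (ht : ∀ i, MeasurableSet (t i)) (hfin : ∀ i, μ (t i) ≠ ⊤)
    (h : ∑ i ∈ s, μ (t i) ≤ μ (⋃ i ∈ s, t i)) {i j : ι} (hi : i ∈ s) (hj : j ∈ s) (hij : i ≠ j) :
    μ (t i ∩ t j) = 0 := by
  classical
  set R := (s.erase i).erase j with hR
  have hj' : j ∈ s.erase i := Finset.mem_erase.2 ⟨hij.symm, hj⟩
  have hsum : ∑ i ∈ s, μ (t i) = (μ (t i) + μ (t j)) + ∑ l ∈ R, μ (t l) := by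
    rw [← Finset.add_sum_erase s _ hi, ← Finset.add_sum_erase _ _ hj', add_assoc]
  have hsub : (⋃ l ∈ s, t l) ⊆ (t i ∪ t j) ∪ ⋃ l ∈ R, t l := by
    intro x hx
    simp only [Set.mem_iUnion] at hx
    obtain ⟨l, hl, hxl⟩ := hx
    by_cases h1 : l = i
    · subst h1; exact Or.inl (Or.inl hxl)
    by_cases h2 : l = j
    · subst h2; exact Or.inl (Or.inr hxl)
    · exact Or.inr (Set.mem_biUnion (Finset.mem_erase.2 ⟨h2, Finset.mem_erase.2 ⟨h1, hl⟩⟩) hxl)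
  have h1 : (μ (t i) + μ (t j)) + ∑ l ∈ R, μ (t l) ≤ μ (t i ∪ t j) + ∑ l ∈ R, μ (t l) := by
    rw [← hsum]
    refine h.trans ((measure_mono hsub).trans ((measure_union_le _ _).trans ?_))
    gcongr
    exact measure_biUnion_finset_le _ _
  have hRfin : ∑ l ∈ R, μ (t l) ≠ ⊤ := ENNReal.sum_ne_top.2 (fun l _ => hfin l)
  have h2 := (ENNReal.add_le_add_iff_right hRfin).1 h1
  rw [← measure_union_add_inter (t i) (ht j)] at h2
  have hU : μ (t i ∪ t j) ≠ ⊤ :=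
    ((measure_union_le _ _).trans_lt (ENNReal.add_lt_top.2 ⟨(hfin i).lt_top, (hfin j).lt_top⟩)).ne
  have h3 : μ (t i ∪ t j) + μ (t i ∩ t j) ≤ μ (t i ∪ t j) + 0 := by simpa using h2
  exact le_antisymm ((ENNReal.add_le_add_iff_left hU).1 h3) (zero_le)

variable {n : ℕ} {A : Matrix (Fin n) (Fin n) ℤ} {D : Set (Fin n → ℤ)}

lemma volume_preimage_inv_pow (hA : A.det ≠ 0) (m : ℕ) (s : Set (Fin n → ℝ)) :
    volume {x | (realMatrix A)⁻¹ ^ m *ᵥ x ∈ s} = (A.det.natAbs : ENNReal) ^ m * volume s := by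
  have hdet : LinearMap.det (Matrix.toLin' ((realMatrix A)⁻¹ ^ m)) = ((A.det : ℝ)⁻¹) ^ m := by
    rw [LinearMap.det_toLin', Matrix.det_pow, Matrix.det_nonsing_inv, det_realMatrix,
      Ring.inverse_eq_inv']
  have hA' : (A.det : ℝ) ≠ 0 := by exact_mod_cast hA
  have h := Measure.addHaar_preimage_linearMap (volume : Measure (Fin n → ℝ))
    (f := Matrix.toLin' ((realMatrix A)⁻¹ ^ m)) (by rw [hdet]; positivity) s
  rw [hdet] at h
  have h2 : ENNReal.ofReal |(((A.det : ℝ)⁻¹) ^ m)⁻¹| = (A.det.natAbs : ENNReal) ^ m := by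
    rw [inv_pow, inv_inv, abs_pow, ENNReal.ofReal_pow (abs_nonneg _)]
    congr 1
    rw [← Int.cast_abs, Int.abs_eq_natAbs, Int.cast_natCast, ENNReal.ofReal_natCast]
  rw [h2] at h
  exact h

lemma volume_sub_mem (s : Set (Fin n → ℝ)) (k : Fin n → ℝ) :
    volume {x | x - k ∈ s} = volume s := by
  have := measure_preimage_add_right volume (-k) s
  simp only [← sub_eq_add_neg] at this
  exact this

/-- Distinct integer translates of the tile overlap in a null set. -/
lemma volume_tile_overlap_eq_zero (hn : 1 ≤ n) (hA : IsDilationMatrix A) (hD : IsDigitSet A D)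
    (h0 : (0 : Fin n → ℤ) ∈ D) (hR : YieldsRadixRepresentation A D) {k l : Fin n → ℤ}
    (hkl : k ≠ l) :
    volume {x | x - toReal k ∈ tile A D ∧ x - toReal l ∈ tile A D} = 0 := by
  have hdet := hA.det_ne_zero
  have hfin := hD.finite hdet
  have hcard := hD.natCard_eq hdet
  have hcomp := isCompact_tile hn hA hfin
  lift D to Finset (Fin n → ℤ) using hfin
  -- After translation by `-l` the two tiles are `T + (k - l)` and `T`; both belong to the family
  -- indexed by `D_m`, since `0 ∈ D_m`.
  obtain ⟨m, hm⟩ := exists_mem_digitSums hR (k - l)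
  have hcardD : D.card = A.det.natAbs := by simpa using hcard
  have hunion : (⋃ e ∈ digitSums A D m, {x | x - toReal e ∈ tile A (D : Set (Fin n → ℤ))}) =
      {x | (realMatrix A)⁻¹ ^ m *ᵥ x ∈ tile A (D : Set (Fin n → ℤ))} := by
    ext x
    simp only [Set.mem_iUnion, Set.mem_ofPred_eq, inv_pow_mulVec_mem_tile_iff hdet, exists_prop]
  have key := measure_inter_eq_zero_of_sum_le (μ := volume) (digitSums A D m)
    (fun e => {x | x - toReal e ∈ tile A (D : Set (Fin n → ℤ))})
    (fun e => hcomp.measurableSet.preimage (measurable_id.sub_const _))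
    (fun e => by rw [volume_sub_mem]; exact hcomp.measure_lt_top.ne)
    (by
      rw [hunion, volume_preimage_inv_pow hdet]
      simp only [volume_sub_mem, Finset.sum_const, nsmul_eq_mul]
      gcongr
      rw [← hcardD]
      exact_mod_cast card_digitSums_le D m)
    hm (zero_mem_digitSums (by exact_mod_cast h0) m) (sub_ne_zero.2 hkl)
  rw [← volume_sub_mem _ (toReal l)] at key
  convert key using 2
  ext x
  simp only [Set.mem_ofPred_eq, Set.mem_inter_iff, toReal_sub, toReal_zero, sub_zero]
  rw [show x - toReal l - (toReal k - toReal l) = x - toReal k by abel]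

/-- The tile has Lebesgue measure one. -/
lemma volume_tile (hn : 1 ≤ n) (hA : IsDilationMatrix A) (hD : IsDigitSet A D)
    (h0 : (0 : Fin n → ℤ) ∈ D) (hR : YieldsRadixRepresentation A D) :
    volume (tile A D) = 1 := by
  let G := (Submodule.span ℤ (Set.range (Pi.basisFun ℝ (Fin n)))).toAddSubgroup
  have hcomp := isCompact_tile hn hA (hD.finite hA.det_ne_zero)
  have hG : ∀ g : Fin n → ℝ, g ∈ G ↔ ∃ k, toReal k = g := by
    intro g
    rw [Submodule.mem_toAddSubgroup, Module.Basis.mem_span_iff_repr_mem]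
    constructor
    · intro h
      choose k hk using h
      exact ⟨k, funext fun i => by simpa using hk i⟩
    · rintro ⟨k, rfl⟩ i
      exact ⟨k i, by simp⟩
  have : Countable G := by
    refine (Set.Countable.mono (s₂ := Set.range (toReal (n := n))) ?_
      (Set.countable_range _)).to_subtype
    intro g hg
    exact (hG g).1 hg
  have h1 : IsAddFundamentalDomain G (tile A D) volume := by
    refine IsAddFundamentalDomain.mk'' hcomp.measurableSet.nullMeasurableSet ?_ ?_ ?_
    · refine Eventually.of_forall fun x => ?_
      obtain ⟨k, hk⟩ := exists_sub_mem_tile hn hA hD h0 x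
      refine ⟨-⟨toReal k, (hG _).2 ⟨k, rfl⟩⟩, ?_⟩
      convert hk using 1
      exact neg_add_eq_sub _ _
    · rintro ⟨g, hg⟩ hg0
      obtain ⟨k, rfl⟩ := (hG g).1 hg
      have hk : k ≠ 0 := by
        rintro rfl
        exact hg0 (Subtype.ext toReal_zero)
      have := volume_tile_overlap_eq_zero hn hA hD h0 hR hk
      rw [AEDisjoint]
      convert this using 2
      ext x
      rw [Set.mem_inter_iff, Set.mem_vadd_set_iff_neg_vadd_mem, Set.mem_ofPred_eq, toReal_zero,
        sub_zero]
      refine and_congr_left fun _ => ?_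
      rw [← neg_add_eq_sub]
      rfl
    · intro g
      exact (measurePreserving_vadd g volume).quasiMeasurePreserving
  -- All fundamental domains of `ℤⁿ` have the same measure; the other one here is the unit cube.
  rw [h1.measure_eq (ZSpan.isAddFundamentalDomain' (Pi.basisFun ℝ (Fin n)) volume),
    ZSpan.fundamentalDomain_pi_basisFun, Real.volume_pi_Ico]
  simp

end Measure

/-! ### Radix representations with centered digits -/

section CenteredDigits

variable {n : ℕ} {A : Matrix (Fin n) (Fin n) ℤ}

/-- A linear map expands the norm at least by any lower bound of its singular values. -/
lemma mul_norm_le_norm_of_le_singularValues {E F : Type*} [NormedAddCommGroup E]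
    [InnerProductSpace ℝ E] [FiniteDimensional ℝ E] [NormedAddCommGroup F] [InnerProductSpace ℝ F]
    [FiniteDimensional ℝ F] (T : E →ₗ[ℝ] F) (hn : Module.finrank ℝ E = n) {c : ℝ} (hc : 0 ≤ c)
    (h : ∀ i : Fin n, c ≤ T.singularValues i) (v : E) : c * ‖v‖ ≤ ‖T v‖ := by
  have hS := T.isSymmetric_adjoint_comp_self
  let b := hS.eigenvectorBasis hn
  -- Expansion in an orthonormal eigenbasis of `T* T`, whose eigenvalues are the squared singular
  -- values.
  have h1 : ‖T v‖ ^ 2 = ∑ i : Fin n, T.singularValues i ^ 2 * ‖inner ℝ (b i) v‖ ^ 2 := by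
    have h2 : ‖T v‖ ^ 2 = inner ℝ v ((LinearMap.adjoint T ∘ₗ T) v) := by
      rw [LinearMap.comp_apply, LinearMap.adjoint_inner_right, real_inner_self_eq_norm_sq]
    rw [h2, ← b.sum_inner_mul_inner]
    refine Finset.sum_congr rfl fun i _ => ?_
    rw [← hS (b i) v, hS.apply_eigenvectorBasis hn i, T.sq_singularValues_fin hn i,
      real_inner_smul_left, real_inner_comm, Real.norm_eq_abs, sq_abs]
    simp only [RCLike.ofReal_real_eq_id, id_eq]
    ring
  refine le_of_sq_le_sq ?_ (norm_nonneg _)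
  rw [h1, mul_pow, ← b.sum_sq_norm_inner_right v, Finset.mul_sum]
  gcongr with i
  exact h i

lemma minSingularValue_sq_mul_sum_sq_le (h : 0 ≤ minSingularValue A) (v : Fin n → ℝ) :
    minSingularValue A ^ 2 * ∑ i, v i ^ 2 ≤ ∑ i, (realMatrix A *ᵥ v) i ^ 2 := by
  have h1 := mul_norm_le_norm_of_le_singularValues (n := n)
    (Matrix.toEuclideanLin (realMatrix A)) (by simp) h
    (fun i => ciInf_le (Set.finite_range _).bddBelow i) (WithLp.toLp 2 v)
  have h2 := pow_le_pow_left₀ (mul_nonneg h (norm_nonneg _)) h1 2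
  rw [mul_pow, EuclideanSpace.norm_sq_eq, EuclideanSpace.norm_sq_eq] at h2
  simpa using h2

/-- Every real number is uniquely an integer plus an element of `[-1/2, 1/2)`. -/
lemma existsUnique_sub_mem_Ico (t : ℝ) : ∃! y : ℤ, t - y ∈ Set.Ico (-(1 / 2) : ℝ) (1 / 2) := by
  have := existsUnique_sub_zsmul_mem_Ico (zero_lt_one' ℝ) t (-(1 / 2))
  norm_num at this ⊢
  exact this

lemma existsUnique_sub_mem_centeredCube (v : Fin n → ℝ) :
    ∃! y : Fin n → ℤ, v - toReal y ∈ centeredCube n := by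
  choose y hy hu using fun i => existsUnique_sub_mem_Ico (v i)
  exact ⟨y, hy, fun z hz => funext fun i => hu i _ (hz i)⟩

lemma mulVec_add_mem_centeredDigits_iff (hA : A.det ≠ 0) (x y : Fin n → ℤ) :
    x - A *ᵥ y ∈ centeredDigits A ↔
      (realMatrix A)⁻¹ *ᵥ toReal x - toReal y ∈ centeredCube n := by
  have h : (realMatrix A)⁻¹ *ᵥ toReal x - toReal y =
      (realMatrix A)⁻¹ *ᵥ toReal (x - A *ᵥ y) := by
    rw [toReal_sub, ← realMatrix_mulVec_toReal, Matrix.mulVec_sub, inv_mulVec_mulVec hA]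
  rw [h]
  constructor
  · rintro ⟨f, hf, hfx⟩
    rw [← hfx]
    dsimp only
    rwa [inv_mulVec_mulVec hA]
  · intro hx
    exact ⟨_, hx, mulVec_inv_mulVec hA _⟩

lemma isDigitSet_centeredDigits (hA : A.det ≠ 0) : IsDigitSet A (centeredDigits A) := by
  intro x
  obtain ⟨y, hy, hu⟩ := existsUnique_sub_mem_centeredCube ((realMatrix A)⁻¹ *ᵥ toReal x)
  refine ⟨x - A *ᵥ y, ⟨(mulVec_add_mem_centeredDigits_iff hA x y).2 hy, y, by abel⟩, ?_⟩
  rintro d ⟨hd, z, hz⟩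
  obtain rfl : d = x - A *ᵥ z := by rw [hz]; abel
  rw [hu z ((mulVec_add_mem_centeredDigits_iff hA x z).1 hd)]

lemma zero_mem_centeredDigits : (0 : Fin n → ℤ) ∈ centeredDigits A :=
  ⟨0, fun i => by norm_num, by simp⟩

/-- For `y ≠ 0`, `|y| ≤ |t| + 1/2 ≤ |t| + |y|/2`. This factor 2 is the source of the bound on the
smallest singular value. -/
lemma abs_le_two_mul_abs_of_sub_mem_Ico {t : ℝ} {y : ℤ}
    (h : t - y ∈ Set.Ico (-(1 / 2) : ℝ) (1 / 2)) : |(y : ℝ)| ≤ 2 * |t| := by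
  rcases eq_or_ne y 0 with rfl | hy
  · simp
  have h1 : (1 : ℝ) ≤ |(y : ℝ)| := by exact_mod_cast Int.one_le_abs hy
  have h2 : |t - y| ≤ 1 / 2 := abs_le.2 ⟨h.1, h.2.le⟩
  have h3 : |(y : ℝ)| ≤ |t| + |t - y| := by
    have := abs_sub t (t - y)
    rwa [sub_sub_cancel] at this
  linarith

lemma exists_digit_sum_sq_lt (hA : A.det ≠ 0) (h : 2 < minSingularValue A) {x : Fin n → ℤ}
    (hx : x ≠ 0) : ∃ y : Fin n → ℤ, x - A *ᵥ y ∈ centeredDigits A ∧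
      ∑ i, y i ^ 2 < ∑ i, x i ^ 2 := by
  obtain ⟨y, hy, -⟩ := existsUnique_sub_mem_centeredCube ((realMatrix A)⁻¹ *ᵥ toReal x)
  refine ⟨y, (mulVec_add_mem_centeredDigits_iff hA x y).2 hy, ?_⟩
  set v := (realMatrix A)⁻¹ *ᵥ toReal x with hv
  have h1 : ∑ i, (y i : ℝ) ^ 2 ≤ 4 * ∑ i, v i ^ 2 := by
    rw [Finset.mul_sum]
    refine Finset.sum_le_sum fun i _ => ?_
    have := pow_le_pow_left₀ (abs_nonneg _) (abs_le_two_mul_abs_of_sub_mem_Ico (hy i)) 2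
    rw [mul_pow, sq_abs, sq_abs] at this
    linarith
  have h2 := minSingularValue_sq_mul_sum_sq_le (by linarith : 0 ≤ minSingularValue A) v
  rw [hv, mulVec_inv_mulVec hA, ← hv] at h2
  have h3 : 0 < ∑ i, (toReal x i) ^ 2 := by
    obtain ⟨i, hi⟩ := Function.ne_iff.1 hx
    refine Finset.sum_pos' (fun i _ => sq_nonneg _) ⟨i, Finset.mem_univ _, ?_⟩
    have : toReal x i ≠ 0 := by simpa using hi
    positivity
  have h4 : 4 < minSingularValue A ^ 2 := by nlinarith
  have h5 : (0 : ℝ) ≤ ∑ i, v i ^ 2 := Finset.sum_nonneg fun i _ => sq_nonneg _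
  have h6 : ∑ i, (y i : ℝ) ^ 2 < ∑ i, (toReal x i) ^ 2 := by
    -- Strictness comes from `x ≠ 0` when `v = 0`, and otherwise from `4 < μ²`.
    rcases h5.eq_or_lt with h0 | h0
    · rw [← h0] at h1; linarith
    · nlinarith
  simp only [toReal_apply] at h6
  exact_mod_cast h6

/-- Strong induction on the squared Euclidean norm: expand the smaller vector `y`, shift its digits
up one place, and put `x - A y` in the lowest place. -/
lemma yieldsRadixRepresentation_centeredDigits (hA : A.det ≠ 0) (h : 2 < minSingularValue A) :
    YieldsRadixRepresentation A (centeredDigits A) := by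
  intro x
  induction hN : (∑ i, x i ^ 2).toNat using Nat.strong_induction_on generalizing x with
  | _ N ih =>
  rcases eq_or_ne x 0 with rfl | hx
  · exact ⟨0, fun _ => 0, fun _ _ => zero_mem_centeredDigits, by simp⟩
  obtain ⟨y, hy, hlt⟩ := exists_digit_sum_sq_lt hA h hx
  have hy0 : 0 ≤ ∑ i, y i ^ 2 := Finset.sum_nonneg fun i _ => sq_nonneg _
  obtain ⟨M, d, hd, hsum⟩ := ih _ (by omega) y rfl
  refine ⟨M + 1, fun j => Nat.casesOn j (x - A *ᵥ y) d, fun j hj => ?_, ?_⟩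
  · cases j with
    | zero => exact hy
    | succ j => exact hd j (by omega)
  · rw [Finset.sum_range_succ']
    have : ∑ j ∈ Finset.range (M + 1), A ^ (j + 1) *ᵥ d j = A *ᵥ y := by
      rw [hsum, Matrix.mulVec_sum]
      simp [pow_succ', Matrix.mulVec_mulVec]
    rw [this]
    simp

end CenteredDigits

/-! ### Invertible linear changes of variables -/

section ChangeOfVariables

variable {n : ℕ} {M : Matrix (Fin n) (Fin n) ℝ}

lemma measurableEmbedding_mulVec (hM : IsUnit M.det) :
    MeasurableEmbedding (fun x : Fin n → ℝ => M *ᵥ x) :=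
  (LinearMap.continuous_of_finiteDimensional (Matrix.mulVecLin M)).measurableEmbedding
    (Matrix.mulVec_injective_iff_isUnit.2 ((Matrix.isUnit_iff_isUnit_det M).2 hM))

lemma map_mulVec_volume (hM : IsUnit M.det) :
    Measure.map (fun x : Fin n → ℝ => M *ᵥ x) volume = ENNReal.ofReal |M.det⁻¹| • volume :=
  Real.map_matrix_volume_pi_eq_smul_volume_pi hM.ne_zero

lemma ofReal_abs_det_inv_ne_zero (hM : IsUnit M.det) : ENNReal.ofReal |M.det⁻¹| ≠ 0 :=
  (ENNReal.ofReal_pos.2 (abs_pos.2 (inv_ne_zero hM.ne_zero))).ne'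

lemma ae_mulVec_iff (hM : IsUnit M.det) {p : (Fin n → ℝ) → Prop} :
    (∀ᵐ x, p (M *ᵥ x)) ↔ ∀ᵐ x, p x := by
  rw [← (measurableEmbedding_mulVec hM).ae_map_iff, map_mulVec_volume hM]
  exact Measure.ae_ennreal_smul_measure_iff (ofReal_abs_det_inv_ne_zero hM)

lemma memLp_comp_mulVec_iff {E : Type*} [NormedAddCommGroup E] {p : ENNReal} (hM : IsUnit M.det)
    {f : (Fin n → ℝ) → E} : MemLp (fun x => f (M *ᵥ x)) p volume ↔ MemLp f p volume := by
  have h := (measurableEmbedding_mulVec hM).memLp_map_measure_iff (g := f) (p := p)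
    (μ := volume)
  rw [map_mulVec_volume hM] at h
  refine h.symm.trans ⟨fun hf => ?_, fun hf => hf.smul_measure ENNReal.ofReal_ne_top⟩
  have := hf.smul_measure (c := (ENNReal.ofReal |M.det⁻¹|)⁻¹)
    (ENNReal.inv_ne_top.2 (ofReal_abs_det_inv_ne_zero hM))
  rwa [smul_smul, ENNReal.inv_mul_cancel (ofReal_abs_det_inv_ne_zero hM) ENNReal.ofReal_ne_top,
    one_smul] at this

end ChangeOfVariables

/-! ### Cells: images of the tile at all scales -/

section Cells

variable {n : ℕ} {A : Matrix (Fin n) (Fin n) ℤ} {D : Set (Fin n → ℤ)}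

/-- The set `A^{-j}(T + k)`, where `T` is the tile. -/
def cell (A : Matrix (Fin n) (Fin n) ℤ) (D : Set (Fin n → ℤ)) (j : ℤ) (k : Fin n → ℤ) :
    Set (Fin n → ℝ) :=
  {x | realMatrix A ^ j *ᵥ x - toReal k ∈ tile A D}

lemma mem_cell_zero {k : Fin n → ℤ} {x : Fin n → ℝ} :
    x ∈ cell A D 0 k ↔ x - toReal k ∈ tile A D := by
  simp [cell]

lemma isUnit_det_zpow (hA : A.det ≠ 0) (j : ℤ) : IsUnit (realMatrix A ^ j).det :=
  Matrix.isUnit_det_zpow_iff.2 (Or.inl (isUnit_det_realMatrix hA))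

lemma mem_cell_succ (hA : A.det ≠ 0) {j : ℤ} {k : Fin n → ℤ} {x : Fin n → ℝ} :
    x ∈ cell A D (j + 1) k ↔ realMatrix A *ᵥ x ∈ cell A D j k := by
  rw [cell, cell, Set.mem_ofPred_eq, Set.mem_ofPred_eq,
    Matrix.zpow_add_one (isUnit_det_realMatrix hA), Matrix.mulVec_mulVec]

lemma mem_cell_neg {m : ℕ} {x : Fin n → ℝ} :
    x ∈ cell A D (-m) 0 ↔ (realMatrix A)⁻¹ ^ m *ᵥ x ∈ tile A D := by
  rw [cell, Set.mem_ofPred_eq, Matrix.zpow_neg_natCast, Matrix.inv_pow', toReal_zero, sub_zero]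

/-- The cells of one level are contained in those of the previous one. -/
lemma exists_cell_succ_subset (hA : A.det ≠ 0) (hD : IsDigitSet A D) (j : ℤ) (k : Fin n → ℤ) :
    ∃ l, cell A D (j + 1) k ⊆ cell A D j l := by
  obtain ⟨d, ⟨hd, y, hy⟩, -⟩ := hD k
  refine ⟨y, fun x hx => (mem_tile_iff hA).2 ⟨d, hd, ?_⟩⟩
  have h : realMatrix A ^ (j + 1) *ᵥ x - toReal k ∈ tile A D := hx
  rw [add_comm, Matrix.zpow_one_add (isUnit_det_realMatrix hA), ← Matrix.mulVec_mulVec, hy,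
    toReal_add, ← realMatrix_mulVec_toReal, ← sub_sub] at h
  rwa [Matrix.mulVec_sub]

lemma measurableSet_cell (hT : IsCompact (tile A D)) (j : ℤ) (k : Fin n → ℤ) :
    MeasurableSet (cell A D j k) := by
  have hc : Continuous (fun x : Fin n → ℝ => realMatrix A ^ j *ᵥ x - toReal k) :=
    (LinearMap.continuous_of_finiteDimensional
      (Matrix.mulVecLin (realMatrix A ^ j))).sub continuous_const
  exact hT.measurableSet.preimage hc.measurable

lemma exists_mem_cell (hcov : ∀ x, ∃ k, x - toReal k ∈ tile A D) (j : ℤ) (x : Fin n → ℝ) :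
    ∃ k, x ∈ cell A D j k :=
  hcov _

lemma ae_cell_unique (hA : A.det ≠ 0)
    (hdisj : ∀ k l : Fin n → ℤ, k ≠ l →
      volume {x | x - toReal k ∈ tile A D ∧ x - toReal l ∈ tile A D} = 0)
    (j : ℤ) : ∀ᵐ x, ∀ k l, x ∈ cell A D j k → x ∈ cell A D j l → k = l := by
  refine (ae_mulVec_iff (isUnit_det_zpow hA j) (p := fun y => ∀ k l,
    y - toReal k ∈ tile A D → y - toReal l ∈ tile A D → k = l)).2 ?_
  rw [ae_all_iff]
  intro k
  rw [ae_all_iff]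
  intro l
  by_cases hkl : k = l
  · exact Eventually.of_forall fun _ _ _ => hkl
  · filter_upwards [measure_eq_zero_iff_ae_notMem.1 (hdisj k l hkl)] with y hy h1 h2
    exact absurd ⟨h1, h2⟩ hy

/-- A level `j` cell is an `A^{-j}` image of a translate of the tile. Monotonicity of `δ` later
keeps every approximating set inside one compact neighbourhood. -/
lemma dist_le_of_mem_cell (hn : 1 ≤ n) (hA : IsDilationMatrix A) (hT : IsCompact (tile A D)) :
    ∃ δ : ℕ → ℝ, Antitone δ ∧ Tendsto δ atTop (𝓝 0) ∧
      ∀ (j : ℕ) (k : Fin n → ℤ), ∀ x ∈ cell A D j k, ∀ y ∈ cell A D j k, dist x y ≤ δ j := by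
  obtain ⟨C, r, hC, hr0, hr1, hB⟩ := hA.exists_norm_inv_pow_mulVec_le hn
  refine ⟨fun j => C * r ^ j * Metric.diam (tile A D), ?_, ?_, ?_⟩
  · intro i j hij
    have := pow_le_pow_of_le_one hr0.le hr1.le hij
    have := Metric.diam_nonneg (s := tile A D)
    dsimp only
    gcongr
  · simpa using ((tendsto_pow_atTop_nhds_zero_of_lt_one hr0.le hr1).const_mul C).mul_const
      (Metric.diam (tile A D))
  · intro j k x hx y hy
    have h1 : x - y = (realMatrix A)⁻¹ ^ j *ᵥ
        ((realMatrix A ^ (j : ℤ) *ᵥ x - toReal k) - (realMatrix A ^ (j : ℤ) *ᵥ y - toReal k)) := by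
      rw [sub_sub_sub_cancel_right, ← Matrix.mulVec_sub, Matrix.mulVec_mulVec, zpow_natCast,
        Matrix.inv_pow', Matrix.nonsing_inv_mul, Matrix.one_mulVec]
      rw [Matrix.det_pow]
      exact (isUnit_det_realMatrix hA.det_ne_zero).pow j
    rw [dist_eq_norm, h1]
    refine (hB _ _).trans (mul_le_mul_of_nonneg_left ?_ (by positivity))
    rw [← dist_eq_norm]
    exact Metric.dist_le_diam_of_mem hT.isBounded hx hy

end Cells

/-! ### The multiresolution analysis -/

section Multiresolution

variable {𝕜 : Type*} [RCLike 𝕜] {n : ℕ} {A : Matrix (Fin n) (Fin n) ℤ} {D : Set (Fin n → ℤ)}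

/-- `f` is almost everywhere constant on every cell of level `j`. -/
def ConstOnCells {E : Type*} (A : Matrix (Fin n) (Fin n) ℤ) (D : Set (Fin n → ℤ)) (j : ℤ)
    (f : (Fin n → ℝ) → E) : Prop :=
  ∀ k, ∃ c, ∀ᵐ x, x ∈ cell A D j k → f x = c

lemma ConstOnCells.congr {E : Type*} {j : ℤ} {f g : (Fin n → ℝ) → E} (hf : ConstOnCells A D j f)
    (h : f =ᵐ[volume] g) : ConstOnCells A D j g := by
  intro k
  obtain ⟨c, hc⟩ := hf k
  exact ⟨c, by filter_upwards [hc, h] with x h1 h2 h3; rw [← h2, h1 h3]⟩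

variable (𝕜 A D) in
/-- The space of square integrable functions that are constant on the cells of level `j`. -/
def cellSpace (j : ℤ) : Submodule 𝕜 (L2 𝕜 n) where
  carrier := {f | ConstOnCells A D j (f : (Fin n → ℝ) → 𝕜)}
  zero_mem' k := ⟨0, by filter_upwards [Lp.coeFn_zero 𝕜 2 volume] with x hx _ using hx⟩
  add_mem' {f g} hf hg k := by
    obtain ⟨c, hc⟩ := hf k
    obtain ⟨d, hd⟩ := hg k
    refine ⟨c + d, ?_⟩
    filter_upwards [hc, hd, Lp.coeFn_add f g] with x h1 h2 h3 hx
    rw [h3, Pi.add_apply, h1 hx, h2 hx]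
  smul_mem' a f hf k := by
    obtain ⟨c, hc⟩ := hf k
    refine ⟨a • c, ?_⟩
    filter_upwards [hc, Lp.coeFn_smul a f] with x h1 h3 hx
    rw [h3, Pi.smul_apply, h1 hx]

lemma represents_cellSpace_iff {j : ℤ} {f : (Fin n → ℝ) → 𝕜} :
    Represents (cellSpace 𝕜 A D j) f ↔ MemLp f 2 volume ∧ ConstOnCells A D j f := by
  constructor
  · rintro ⟨g, hg, hgf⟩
    exact ⟨(memLp_congr_ae hgf).1 (Lp.memLp g), ConstOnCells.congr hg hgf⟩
  · rintro ⟨hf, hc⟩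
    exact ⟨hf.toLp f, hc.congr hf.coeFn_toLp.symm, hf.coeFn_toLp⟩

/-- Along an almost everywhere convergent subsequence the constants on a non-null cell converge, so
the limit is constant there. On a null cell any constant serves. -/
lemma isClosed_cellSpace (j : ℤ) : IsClosed (cellSpace 𝕜 A D j : Set (L2 𝕜 n)) := by
  refine IsSeqClosed.isClosed fun f g hf hfg k => ?_
  obtain ⟨ns, -, hns⟩ := (tendstoInMeasure_of_tendsto_Lp hfg).exists_seq_tendsto_ae
  choose c hc using fun i => hf (ns i) k
  have hall : ∀ᵐ x, x ∈ cell A D j k → Tendsto c atTop (𝓝 (g x)) := by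
    filter_upwards [hns, ae_all_iff.2 hc] with x h1 h2 hx
    exact h1.congr fun i => h2 i hx
  by_cases hnull : ∀ᵐ x, x ∉ cell A D j k
  · exact ⟨0, by filter_upwards [hnull] with x hx hx' using absurd hx' hx⟩
  · obtain ⟨x₀, hx₀, h₀⟩ := ((not_eventually.1 hnull).and_eventually hall).exists
    refine ⟨g x₀, ?_⟩
    filter_upwards [hall] with x hx hxk
    exact tendsto_nhds_unique (hx hxk) (h₀ (not_not.1 hx₀))

lemma cellSpace_le_succ (hA : A.det ≠ 0) (hD : IsDigitSet A D) (j : ℤ) :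
    cellSpace 𝕜 A D j ≤ cellSpace 𝕜 A D (j + 1) := by
  intro f hf k
  obtain ⟨l, hl⟩ := exists_cell_succ_subset hA hD j k
  obtain ⟨c, hc⟩ := hf l
  exact ⟨c, hc.mono fun x hx hxk => hx (hl hxk)⟩

lemma represents_comp_mulVec_iff (hA : A.det ≠ 0) (j : ℤ) (f : (Fin n → ℝ) → 𝕜) :
    Represents (cellSpace 𝕜 A D j) f ↔
      Represents (cellSpace 𝕜 A D (j + 1)) (fun x => f (realMatrix A *ᵥ x)) := by
  rw [represents_cellSpace_iff, represents_cellSpace_iff,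
    memLp_comp_mulVec_iff (isUnit_det_realMatrix hA)]
  refine and_congr_right fun _ => forall_congr' fun k => exists_congr fun c => ?_
  simp only [mem_cell_succ hA]
  exact (ae_mulVec_iff (isUnit_det_realMatrix hA)
    (p := fun y => y ∈ cell A D j k → f y = c)).symm

lemma Represents.comp_sub {f : (Fin n → ℝ) → 𝕜} (hf : Represents (cellSpace 𝕜 A D 0) f)
    (k : Fin n → ℤ) : Represents (cellSpace 𝕜 A D 0) (fun x => f (x - toReal k)) := by
  rw [represents_cellSpace_iff] at hf ⊢
  have hmp := measurePreserving_sub_right (volume : Measure (Fin n → ℝ)) (toReal k)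
  refine ⟨hf.1.comp_measurePreserving hmp, fun l => ?_⟩
  obtain ⟨c, hc⟩ := hf.2 (l - k)
  refine ⟨c, (hmp.quasiMeasurePreserving.ae hc).mono fun x hx hxl => hx ?_⟩
  rw [mem_cell_zero] at hxl ⊢
  rwa [toReal_sub, sub_sub_sub_cancel_right]

lemma represents_comp_sub_iff (k : Fin n → ℤ) (f : (Fin n → ℝ) → 𝕜) :
    Represents (cellSpace 𝕜 A D 0) f ↔
      Represents (cellSpace 𝕜 A D 0) (fun x => f (x - toReal k)) := by
  refine ⟨fun hf => hf.comp_sub k, fun hf => ?_⟩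
  have h0 : toReal (-k) = -toReal k := by ext; simp
  simpa [h0] using hf.comp_sub (-k)

/-- The indicator function of a union of cells of level `j` belongs to the `j`-th space. -/
lemma indicatorConstLp_mem_cellSpace (hA : A.det ≠ 0)
    (hdisj : ∀ k l : Fin n → ℤ, k ≠ l →
      volume {x | x - toReal k ∈ tile A D ∧ x - toReal l ∈ tile A D} = 0)
    {j : ℤ} (F : Set (Fin n → ℤ)) {S : Set (Fin n → ℝ)} (hS : S = ⋃ k ∈ F, cell A D j k)
    (hm : MeasurableSet S) (hfin : volume S ≠ ⊤) :
    indicatorConstLp 2 hm hfin (1 : 𝕜) ∈ cellSpace 𝕜 A D j := by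
  classical
  intro l
  refine ⟨if l ∈ F then 1 else 0, ?_⟩
  filter_upwards [indicatorConstLp_coeFn (p := 2) (hs := hm) (hμs := hfin) (c := (1 : 𝕜)),
    ae_cell_unique hA hdisj j] with x h1 h2 hx
  rw [h1]
  have : x ∈ S ↔ l ∈ F := by
    rw [hS, Set.mem_iUnion₂]
    constructor
    · rintro ⟨k, hk, hxk⟩
      rwa [h2 l k hx hxk]
    · exact fun hl => ⟨l, hl, hx⟩
  by_cases hl : l ∈ F
  · rw [Set.indicator_of_mem (this.2 hl), if_pos hl]
  · rw [Set.indicator_of_notMem (fun h => hl (this.1 h)), if_neg hl]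

lemma iInter_cellSpace (hn : 1 ≤ n) (hA : IsDilationMatrix A) (hD : IsDigitSet A D)
    (h0 : (0 : Fin n → ℤ) ∈ D) (hR : YieldsRadixRepresentation A D) :
    (⋂ j, (cellSpace 𝕜 A D j : Set (L2 𝕜 n))) = {0} := by
  have hdet := hA.det_ne_zero
  have hvol := volume_tile hn hA hD h0 hR
  have hcov := exists_sub_mem_tile hn hA hD h0
  have hfin := hD.finite hdet
  refine Set.Subset.antisymm ?_ (by simp)
  intro f hf
  choose c hc using fun m : ℕ => (Set.mem_iInter.1 hf (-(m : ℤ))) 0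
  lift D to Finset (Fin n → ℤ) using hfin
  have hsub : ∀ (m : ℕ), tile A (D : Set (Fin n → ℤ)) ⊆ cell A D (-(m : ℤ)) 0 := fun m x hx =>
    mem_cell_neg.2 ((inv_pow_mulVec_mem_tile_iff hdet D m x).2
      ⟨0, zero_mem_digitSums (by exact_mod_cast h0) m, by simpa using hx⟩)
  -- Every `A^m T` contains `T`, which has positive measure, so the constants agree.
  have hc0 : ∀ m, c m = c 0 := by
    intro m
    have hfreq : ∃ᵐ x, x ∈ tile A (D : Set (Fin n → ℤ)) := by
      rw [frequently_ae_mem_iff, hvol]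
      exact one_ne_zero
    obtain ⟨x, hx, h1, h2⟩ := (hfreq.and_eventually ((hc m).and (hc 0))).exists
    rw [← h1 (hsub m hx), h2 (hsub 0 hx)]
  have hconst : (f : (Fin n → ℝ) → 𝕜) =ᵐ[volume] fun _ => c 0 := by
    filter_upwards [ae_all_iff.2 hc] with x hx
    obtain ⟨k, hk⟩ := hcov x
    obtain ⟨m, hm⟩ := exists_mem_digitSums hR k
    rw [hx m (mem_cell_neg.2 ((inv_pow_mulVec_mem_tile_iff hdet D m x).2 ⟨k, hm, hk⟩)), hc0]
  have hmem := (memLp_congr_ae hconst).1 (Lp.memLp f)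
  have : Nonempty (Fin n) := ⟨⟨0, hn⟩⟩
  have : Nontrivial (Fin n → ℝ) := inferInstance
  have : NoncompactSpace (Fin n → ℝ) := NormedSpace.noncompactSpace ℝ _
  rw [memLp_const_iff (by norm_num) (by norm_num), measure_univ_of_isAddLeftInvariant] at hmem
  have hc00 : c 0 = 0 := by simpa using hmem
  rw [Set.mem_singleton_iff]
  refine Lp.ext (hconst.trans ?_)
  rw [hc00]
  exact (Lp.coeFn_zero 𝕜 2 volume).symm

/-- A function orthogonal to all the spaces has vanishing integral over every compact set. -/
lemma setIntegral_eq_zero_of_orthogonal (hn : 1 ≤ n) (hA : IsDilationMatrix A)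
    (hT : IsCompact (tile A D)) (hcov : ∀ x, ∃ k, x - toReal k ∈ tile A D)
    (hdisj : ∀ k l : Fin n → ℤ, k ≠ l →
      volume {x | x - toReal k ∈ tile A D ∧ x - toReal l ∈ tile A D} = 0)
    {g : L2 𝕜 n} (hg : ∀ j, ∀ f ∈ cellSpace 𝕜 A D j, inner 𝕜 f g = 0)
    {K : Set (Fin n → ℝ)} (hK : IsCompact K) : ∫ x in K, g x = 0 := by
  obtain ⟨δ, hδanti, hδ, hdist⟩ := dist_le_of_mem_cell hn hA hT
  -- `S j`, the union of the level `j` cells meeting `K`, shrinks to `K`. Its indicator lies in the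
  -- `j`-th space, so `g` integrates to zero over it.
  let F : ℕ → Set (Fin n → ℤ) := fun j => {k | (cell A D j k ∩ K).Nonempty}
  let S : ℕ → Set (Fin n → ℝ) := fun j => ⋃ k ∈ F j, cell A D j k
  have hSm : ∀ j, MeasurableSet (S j) := fun j =>
    MeasurableSet.biUnion (Set.to_countable _) fun k _ => measurableSet_cell hT j k
  have hSsub : ∀ j, ∀ x ∈ S j, ∃ y ∈ K, dist x y ≤ δ j := by
    intro j x hx
    obtain ⟨k, ⟨y, hy, hyK⟩, hxk⟩ := Set.mem_iUnion₂.1 hx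
    exact ⟨y, hyK, hdist j k x hxk y hy⟩
  have hKS : ∀ j, K ⊆ S j := by
    intro j x hx
    obtain ⟨k, hk⟩ := exists_mem_cell hcov j x
    exact Set.mem_iUnion₂.2 ⟨k, ⟨x, hk, hx⟩, hk⟩
  have hScth : ∀ j, S j ⊆ Metric.cthickening (δ 0) K := by
    intro j x hx
    obtain ⟨y, hy, hxy⟩ := hSsub j x hx
    exact Metric.mem_cthickening_of_dist_le x y _ _ hy (hxy.trans (hδanti (Nat.zero_le j)))
  have hcth : IsCompact (Metric.cthickening (δ 0) K) := hK.cthickening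
  have hSfin : ∀ j, volume (S j) ≠ ⊤ := fun j =>
    ((measure_mono (hScth j)).trans_lt hcth.measure_lt_top).ne
  have hS0 : ∀ j, ∫ x, (S j).indicator g x = 0 := by
    intro j
    rw [integral_indicator (hSm j), ← L2.inner_indicatorConstLp_one (hSm j) (hSfin j) g]
    exact hg j _ (indicatorConstLp_mem_cellSpace hA.det_ne_zero hdisj (F j) rfl _ _)
  have hint : IntegrableOn (g : (Fin n → ℝ) → 𝕜) (Metric.cthickening (δ 0) K) :=
    ((Lp.memLp g).locallyIntegrable (by norm_num)).integrableOn_isCompact hcth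
  have hlim : Tendsto (fun j => ∫ x, (S j).indicator g x) atTop (𝓝 (∫ x, K.indicator g x)) := by
    refine tendsto_integral_of_dominated_convergence
      ((Metric.cthickening (δ 0) K).indicator fun x => ‖g x‖) ?_ ?_ ?_ ?_
    · exact fun j => (Lp.aestronglyMeasurable g).indicator (hSm j)
    · exact (integrable_indicator_iff hcth.measurableSet).2 hint.norm
    · refine fun j => Eventually.of_forall fun x => ?_
      rw [norm_indicator_eq_indicator_norm]
      exact Set.indicator_le_indicator_of_subset (hScth j) (fun _ => norm_nonneg _) x
    · refine Eventually.of_forall fun x => ?_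
      by_cases hx : x ∈ K
      · rw [Set.indicator_of_mem hx]
        refine tendsto_const_nhds.congr fun j => ?_
        rw [Set.indicator_of_mem (hKS j hx)]
      · rw [Set.indicator_of_notMem hx]
        -- A point off the closed set `K` leaves `S j` once `δ j` is below its distance to `K`.
        obtain ⟨ε, hε, hball⟩ := Metric.isOpen_iff.1 hK.isClosed.isOpen_compl x hx
        refine tendsto_const_nhds.congr' ?_
        filter_upwards [hδ.eventually_lt_const hε] with j hj
        rw [Set.indicator_of_notMem]
        intro hxS
        obtain ⟨y, hy, hxy⟩ := hSsub j x hxS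
        exact hball (Metric.mem_ball'.2 (hxy.trans_lt hj)) hy
  simp only [hS0] at hlim
  rw [← integral_indicator hK.measurableSet]
  exact tendsto_nhds_unique hlim tendsto_const_nhds

lemma closure_iUnion_cellSpace (hn : 1 ≤ n) (hA : IsDilationMatrix A) (hD : IsDigitSet A D)
    (hT : IsCompact (tile A D)) (hcov : ∀ x, ∃ k, x - toReal k ∈ tile A D)
    (hdisj : ∀ k l : Fin n → ℤ, k ≠ l →
      volume {x | x - toReal k ∈ tile A D ∧ x - toReal l ∈ tile A D} = 0) :
    closure (⋃ j, (cellSpace 𝕜 A D j : Set (L2 𝕜 n))) = Set.univ := by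
  have hmono : Monotone (cellSpace 𝕜 A D) :=
    monotone_int_of_le_succ fun j => cellSpace_le_succ hA.det_ne_zero hD j
  rw [← Submodule.coe_iSup_of_directed _ hmono.directed_le, ← Submodule.topologicalClosure_coe,
    Submodule.topologicalClosure_eq_top_iff.2, Submodule.top_coe]
  rw [Submodule.eq_bot_iff]
  intro g hg
  have hg' : ∀ j, ∀ f ∈ cellSpace 𝕜 A D j, inner 𝕜 f g = 0 := fun j f hf =>
    (Submodule.mem_orthogonal _ _).1 hg f (Submodule.mem_iSup_of_mem j hf)
  refine Lp.ext (.trans ?_ (Lp.coeFn_zero 𝕜 2 volume).symm)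
  exact ae_eq_zero_of_forall_setIntegral_isCompact_eq_zero'
    ((Lp.memLp g).locallyIntegrable (by norm_num))
    fun K hK => setIntegral_eq_zero_of_orthogonal hn hA hT hcov hdisj hg' hK

/-- The indicator function of the tile is a scaling function for the space of functions that are
constant on its integer translates. -/
lemma isScalingFunction_indicator_tile (hA : A.det ≠ 0) (hT : IsCompact (tile A D))
    (hvol : volume (tile A D) = 1) (hcov : ∀ x, ∃ k, x - toReal k ∈ tile A D)
    (hdisj : ∀ k l : Fin n → ℤ, k ≠ l →
      volume {x | x - toReal k ∈ tile A D ∧ x - toReal l ∈ tile A D} = 0) :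
    IsScalingFunction (cellSpace 𝕜 A D 0) ((tile A D).indicator (fun _ => (1 : 𝕜))) := by
  have hm : ∀ k, MeasurableSet (cell A D 0 k) := measurableSet_cell hT 0
  have hcell : ∀ k, cell A D 0 k = {x | x - toReal k ∈ tile A D} := fun k =>
    Set.ext fun x => mem_cell_zero
  have hv : ∀ k, volume (cell A D 0 k) = 1 := fun k => by rw [hcell, volume_sub_mem, hvol]
  have hfin : ∀ k, volume (cell A D 0 k) ≠ ⊤ := fun k => by rw [hv]; exact ENNReal.one_ne_top
  let e : (Fin n → ℤ) → L2 𝕜 n := fun k => indicatorConstLp 2 (hm k) (hfin k) 1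
  have he : ∀ k, e k ∈ cellSpace 𝕜 A D 0 := fun k =>
    indicatorConstLp_mem_cellSpace hA hdisj {k} (by simp) _ _
  have hcoe : ∀ k, (e k : (Fin n → ℝ) → 𝕜) =ᵐ[volume]
      fun x => (tile A D).indicator (fun _ => (1 : 𝕜)) (x - toReal k) := by
    intro k
    refine indicatorConstLp_coeFn.trans (Eventually.of_forall fun x => ?_)
    dsimp only
    by_cases hx : x - toReal k ∈ tile A D
    · rw [Set.indicator_of_mem hx, Set.indicator_of_mem (mem_cell_zero.2 hx)]
    · rw [Set.indicator_of_notMem hx, Set.indicator_of_notMem (fun h => hx (mem_cell_zero.1 h))]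
  refine ⟨⟨e 0, he 0, by simpa using hcoe 0⟩, e, hcoe, ?_, ?_⟩
  · classical
    rw [orthonormal_iff_ite]
    intro k l
    rw [L2.inner_indicatorConstLp_indicatorConstLp (hm k) (hm l) (hfin k) (hfin l)]
    split_ifs with hkl
    · subst hkl
      simp [Measure.real, hv]
    · have : volume (cell A D 0 k ∩ cell A D 0 l) = 0 := by
        rw [hcell, hcell]
        exact hdisj k l hkl
      simp [Measure.real, this]
  · have hle : (Submodule.span 𝕜 (Set.range e)).topologicalClosure ≤ cellSpace 𝕜 A D 0 :=
      Submodule.topologicalClosure_minimal _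
        (Submodule.span_le.2 (Set.range_subset_iff.2 he)) (isClosed_cellSpace 0)
    have : CompleteSpace (Submodule.span 𝕜 (Set.range e)).topologicalClosure :=
      (Submodule.isClosed_topologicalClosure _).completeSpace_coe
    -- Completeness reduces to this: an element of the space orthogonal to all translates is zero.
    -- Its inner product with `e k` is its constant value on `T + k`, a set of measure one.
    rw [← Submodule.sup_orthogonal_inf_of_hasOrthogonalProjection hle, eq_comm, sup_eq_left]
    refine le_trans (le_of_eq ?_) bot_le
    rw [Submodule.eq_bot_iff]
    rintro g ⟨hg, hgV⟩
    choose c hc using hgV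
    have hc0 : ∀ k, c k = 0 := by
      intro k
      have h1 : inner 𝕜 (e k) g = 0 := (Submodule.mem_orthogonal _ _).1 hg _
        (Submodule.le_topologicalClosure _ (Submodule.subset_span ⟨k, rfl⟩))
      rw [L2.inner_indicatorConstLp_one (hm k) (hfin k), setIntegral_congr_ae (hm k) (hc k)] at h1
      simpa [Measure.real, hv] using h1
    refine Lp.ext (.trans ?_ (Lp.coeFn_zero 𝕜 2 volume).symm)
    filter_upwards [ae_all_iff.2 hc] with x hx
    obtain ⟨k, hk⟩ := exists_mem_cell hcov 0 x
    rw [hx k hk, hc0, Pi.zero_apply]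

/-- If `A` yields a radix representation of `ℤⁿ` with digit set `D`, then the indicator function of
the tile is a scaling function of a multiresolution analysis. -/
theorem isScalingFunctionOfMRA_indicator_tile (hn : 1 ≤ n) (hA : IsDilationMatrix A)
    (hD : IsDigitSet A D) (h0 : (0 : Fin n → ℤ) ∈ D) (hR : YieldsRadixRepresentation A D) :
    IsScalingFunctionOfMRA A ((tile A D).indicator (fun _ => (1 : 𝕜))) := by
  have hdet := hA.det_ne_zero
  have hT := isCompact_tile hn hA (hD.finite hdet)
  have hcov := exists_sub_mem_tile hn hA hD h0
  have hdisj := fun k l => volume_tile_overlap_eq_zero hn hA hD h0 hR (k := k) (l := l)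
  have hφ := isScalingFunction_indicator_tile (𝕜 := 𝕜) hdet hT (volume_tile hn hA hD h0 hR) hcov
    hdisj
  exact ⟨cellSpace 𝕜 A D,
    { isClosed := isClosed_cellSpace
      nested := cellSpace_le_succ hdet hD
      dense := closure_iUnion_cellSpace hn hA hD hT hcov hdisj
      separated := iInter_cellSpace hn hA hD h0 hR
      dilation := represents_comp_mulVec_iff hdet
      translation := represents_comp_sub_iff
      scaling := ⟨_, hφ⟩ }, hφ⟩

end Multiresolution

end RadixMRA

end

theorem mainTheorem3 (𝕜 : Type*) [RCLike 𝕜] {n : ℕ} (hn : 1 ≤ n)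
    (A : Matrix (Fin n) (Fin n) ℤ) (hA : RadixMRA.IsDilationMatrix A) :
    (∀ D : Set (Fin n → ℤ), RadixMRA.IsDigitSet A D → (0 : Fin n → ℤ) ∈ D →
      RadixMRA.YieldsRadixRepresentation A D →
      RadixMRA.IsScalingFunctionOfMRA A
        ((RadixMRA.tile A D).indicator (fun _ => (1 : 𝕜)))) ∧
    (2 < RadixMRA.minSingularValue A →
      RadixMRA.IsScalingFunctionOfMRA A
        ((RadixMRA.tile A (RadixMRA.centeredDigits A)).indicator (fun _ => (1 : 𝕜)))) :=
  ⟨fun _ hD h0 hR => RadixMRA.isScalingFunctionOfMRA_indicator_tile hn hA hD h0 hR,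
    fun h => RadixMRA.isScalingFunctionOfMRA_indicator_tile hn hA
      (RadixMRA.isDigitSet_centeredDigits hA.det_ne_zero) RadixMRA.zero_mem_centeredDigits
      (RadixMRA.yieldsRadixRepresentation_centeredDigits hA.det_ne_zero h)⟩
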